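/- Let $f:\mathbb{R}^d\to\mathbb{R}$ be differentiable, let $w_*$ be a global minimizer of $f$, and let $\rho,\mu,L>0$. Assume that $f$ is $L$-smooth, i.e. $f(x)\le f(y)+\langle\nabla f(y),x-y\rangle+\frac L2\|x-y\|^2$ for all $x,y\in\mathbb{R}^d$, and $(\rho,\mu)$-strongly quasar convex, i.e. $f(w_*)\ge f(w)+\frac1\rho\langle\nabla f(w),w_*-w\rangle+\frac\mu2\|w_*-w\|^2$ for all $w\in\mathbb{R}^d$. Let $T_0=0$ and let $T_1,T_2,\dots$ be random times whose increments $T_1-T_0,\,T_2-T_1,\dots$ are independent and exponentially distributed with mean $1$. Given deterministic initial points $\tilde w_0,\tilde z_0\in\mathbb{R}^d$, define for $k\ge 0$ \[ \tilde v_k=\tilde w_k+\tau_k(\tilde z_k-\tilde w_k),\qquad \tilde w_{k+1}=\tilde v_k-\tfrac1L\nabla f(\tilde v_k),\qquad \tilde z_{k+1}=\tilde z_k+\tau_k'(\tilde v_k-\tilde z_k)-\tfrac{1}{\sqrt{\mu L}}\nabla f(\tilde v_k), \] where, with $E_k:=\exp\left(-(1+\rho)\sqrt{\mu/L}\,(T_{k+1}-T_k)\right)$,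 \[ \tau_k=\frac{1-E_k}{1+\rho},\qquad \tau_k'=\frac{\rho(1-E_k)}{\rho+E_k}. \] Then for every $c\in(0,1)$, every $c_0>1$ and every integer $k\ge1$, with probability at least $1-\frac1{c^2k}-\frac1{c_0}$, \[ f(\tilde w_k)-f(w_*)\le c_0\left(f(\tilde w_0)-f(w_*)+\frac\mu2\|\tilde z_0-w_*\|^2\right)\exp\left(-\rho\sqrt{\frac\mu L}\,(1-c)\,k\right). \] -/

import Mathlib

open MeasureTheory ProbabilityTheory

/-- `f` is `L`-smooth on `ℝᵈ`: `f` is differentiable, and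
`f x ≤ f y + ⟨∇f(y), x - y⟩ + (L/2)‖x - y‖²` for all `x, y`. -/
structure IsLSmooth {d : ℕ} (L : ℝ) (f : EuclideanSpace ℝ (Fin d) → ℝ) : Prop where
  differentiable : Differentiable ℝ f
  upper_bound : ∀ x y : EuclideanSpace ℝ (Fin d),
    f x ≤ f y + inner ℝ (gradient f y) (x - y) + L / 2 * ‖x - y‖ ^ 2

/-- `f` is `(ρ, μ)`-strongly quasar convex on `ℝᵈ` with respect to its global minimizer `wStar`. -/
structure IsStronglyQuasarConvex {d : ℕ} (ρ μ : ℝ) (f : EuclideanSpace ℝ (Fin d) → ℝ)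
    (wStar : EuclideanSpace ℝ (Fin d)) : Prop where
  isMin : ∀ w : EuclideanSpace ℝ (Fin d), f wStar ≤ f w
  quasar : ∀ w : EuclideanSpace ℝ (Fin d),
    f wStar ≥ f w + 1 / ρ * inner ℝ (gradient f w) (wStar - w) + μ / 2 * ‖wStar - w‖ ^ 2

/-- `T 1, T 2, …` are the arrival times of a Poisson process of rate one: with `T 0 = 0`, the
increments `T 1, T 2 - T 1, …` are i.i.d. exponential with mean one. -/
structure IsPoissonArrivalTimes {Ω : Type*} [MeasurableSpace Ω] (P : Measure Ω)
    (T : ℕ → Ω → ℝ) : Prop where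
  measurable : ∀ k, Measurable (T k)
  zero : ∀ ω, T 0 ω = 0
  law : ∀ k, P.map (fun ω => T (k + 1) ω - T k ω) = expMeasure 1
  indep : iIndepFun (fun (k : ℕ) (ω : Ω) => T (k + 1) ω - T k ω) P

/-- The pair `(w̃ₖ, z̃ₖ)` of the discrete algorithm with parameter sequences `τ, τ', γ, γ'`:
`ṽₖ = w̃ₖ + τₖ (z̃ₖ - w̃ₖ)`, `w̃ₖ₊₁ = ṽₖ - γₖ₊₁ ∇f(ṽₖ)`,
`z̃ₖ₊₁ = z̃ₖ + τ'ₖ (ṽₖ - z̃ₖ) - γ'ₖ₊₁ ∇f(ṽₖ)`. -/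
noncomputable def discreteIterates {d : ℕ} (f : EuclideanSpace ℝ (Fin d) → ℝ)
    (τ τ' γ γ' : ℕ → ℝ) (w₀ z₀ : EuclideanSpace ℝ (Fin d)) :
    ℕ → EuclideanSpace ℝ (Fin d) × EuclideanSpace ℝ (Fin d)
  | 0 => (w₀, z₀)
  | k + 1 =>
    let w := (discreteIterates f τ τ' γ γ' w₀ z₀ k).1
    let z := (discreteIterates f τ τ' γ γ' w₀ z₀ k).2
    let v := w + τ k • (z - w)
    (v - γ (k + 1) • gradient f v, z + τ' k • (v - z) - γ' (k + 1) • gradient f v)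

/-- The parameter `τₖ` for times `t 0, t 1, …`. -/
noncomputable def sqcTau (ρ μ L : ℝ) (t : ℕ → ℝ) (k : ℕ) : ℝ :=
  1 / (1 + ρ) * (1 - Real.exp (-(1 + ρ) * √(μ / L) * (t (k + 1) - t k)))

/-- The parameter `τ'ₖ` for times `t 0, t 1, …`. -/
noncomputable def sqcTau' (ρ μ L : ℝ) (t : ℕ → ℝ) (k : ℕ) : ℝ :=
  ρ * (1 - Real.exp (-(1 + ρ) * √(μ / L) * (t (k + 1) - t k))) /
    (ρ + Real.exp (-(1 + ρ) * √(μ / L) * (t (k + 1) - t k)))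

/-- The iterate `w̃ₖ` of the discrete algorithm run along the times `t`, with the parameters for
strongly quasar convex minimization (`γₖ = 1 / L`, `γ'ₖ = 1 / √(μ L)`). -/
noncomputable def sqcIterate {d : ℕ} (ρ μ L : ℝ) (f : EuclideanSpace ℝ (Fin d) → ℝ)
    (w₀ z₀ : EuclideanSpace ℝ (Fin d)) (t : ℕ → ℝ) (k : ℕ) : EuclideanSpace ℝ (Fin d) :=
  (discreteIterates f (sqcTau ρ μ L t) (sqcTau' ρ μ L t)
    (fun _ => 1 / L) (fun _ => 1 / √(μ * L)) w₀ z₀ k).1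

/-! The iteration is a continuous-time process sampled at Poisson times. Between arrivals `(w, z)`
follows a linear flow pulling the two points together (`sqcFlow`); at each arrival both take a
gradient step at the current `w` (`sqcJump`). The parameters `τ`, `τ'` are what the explicit
solution of the flow gives over one waiting time (`discreteIterates_succ_eq_sqcJump_sqcFlow`).

For `V = f w - f w* + (μ/2) ‖z - w*‖²`, smoothness and quasar convexity show that the drift of the
flow plus the jump decreases `V` at rate `ρ √(μ/L)` (`sqcLyapunov_generator_le`). Averaging over an
exponential waiting time turns this into the statement that `exp (ρ √(μ/L) T k) * V` has
nonincreasing mean (`lintegral_exp_mul_sqcLyapunov_le`). Markov's inequality costs probability `1 /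
c₀`. Replacing the random `T k` by `(1 - c) k` costs `1 / (c² k)` by Chebyshev, since `T k` has mean
and variance `k`. -/

/-! ### Averages and moments of the exponential law -/

open Filter Topology in
/-- A function `A ≥ 0` with `A' + B ≤ A` dominates the average of `B` at an exponential time. -/
lemma lintegral_expMeasure_le_of_hasDerivAt {A A' B : ℝ → ℝ} (hA : ∀ t, HasDerivAt A (A' t) t)
    (hA0 : ∀ t, 0 ≤ A t) (hB : ∀ t, 0 ≤ B t) (h : ∀ t, A' t + B t ≤ A t) :
    ∫⁻ t, ENNReal.ofReal (B t) ∂(expMeasure 1) ≤ ENNReal.ofReal (A 0) := by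
  -- `-e⁻ᵗ A t` is nondecreasing and bounded above by `0`, so it converges and its derivative is
  -- integrable; no growth condition on `A` is needed.
  have hg : ∀ t, HasDerivAt (fun t => -(Real.exp (-t) * A t))
      (Real.exp (-t) * (A t - A' t)) t := by
    intro t
    have := (((hasDerivAt_id t).fun_neg.exp).fun_mul (hA t)).fun_neg
    convert! this using 1
    simp only [id]
    ring
  have hg' : ∀ t, 0 ≤ Real.exp (-t) * (A t - A' t) := fun t =>
    mul_nonneg (Real.exp_pos _).le (by linarith [hB t, h t])
  have hmono : Monotone (fun t => -(Real.exp (-t) * A t)) :=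
    monotone_of_deriv_nonneg (fun t => (hg t).differentiableAt)
      (fun t => by rw [(hg t).deriv]; exact hg' t)
  have hbdd : BddAbove (Set.range (fun t => -(Real.exp (-t) * A t))) :=
    ⟨0, by rintro _ ⟨t, rfl⟩; simpa using mul_nonneg (Real.exp_pos (-t)).le (hA0 t)⟩
  have hlim := tendsto_atTop_ciSup hmono hbdd
  have hsup : (⨆ t, -(Real.exp (-t) * A t)) ≤ 0 :=
    ciSup_le fun t => by simpa using mul_nonneg (Real.exp_pos (-t)).le (hA0 t)
  have hcont : ContinuousWithinAt (fun t => -(Real.exp (-t) * A t)) (Set.Ici 0) 0 :=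
    (hg 0).continuousAt.continuousWithinAt
  have hint := integrableOn_Ioi_deriv_of_nonneg hcont (fun t _ => hg t) (fun t _ => hg' t) hlim
  have hval := integral_Ioi_of_hasDerivAt_of_nonneg hcont (fun t _ => hg t) (fun t _ => hg' t) hlim
  calc ∫⁻ t, ENNReal.ofReal (B t) ∂(expMeasure 1)
      = ∫⁻ t, exponentialPDF 1 t * ENNReal.ofReal (B t) := by
        change ∫⁻ t, ENNReal.ofReal (B t) ∂(volume.withDensity (exponentialPDF 1)) = _
        have hm : Measurable (exponentialPDF 1) := (measurable_exponentialPDFReal 1).ennreal_ofReal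
        rw [lintegral_withDensity_eq_lintegral_mul_non_measurable _ hm
          (ae_of_all _ fun _ => ENNReal.ofReal_lt_top)]
        rfl
    _ ≤ ∫⁻ t, (Set.Ici (0 : ℝ)).indicator
          (fun t => ENNReal.ofReal (Real.exp (-t) * (A t - A' t))) t := by
        refine lintegral_mono fun t => ?_
        by_cases ht : 0 ≤ t
        · rw [Set.indicator_of_mem (Set.mem_Ici.2 ht), exponentialPDF_of_nonneg ht,
            ← ENNReal.ofReal_mul (by positivity)]
          refine ENNReal.ofReal_le_ofReal ?_
          rw [one_mul, one_mul]
          exact mul_le_mul_of_nonneg_left (by linarith [h t]) (Real.exp_pos _).le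
        · rw [exponentialPDF_of_neg (not_le.1 ht), zero_mul]
          exact zero_le
    _ = ∫⁻ t in Set.Ioi (0 : ℝ), ENNReal.ofReal (Real.exp (-t) * (A t - A' t)) := by
        rw [lintegral_indicator measurableSet_Ici, setLIntegral_congr Ioi_ae_eq_Ici]
    _ = ENNReal.ofReal (∫ t in Set.Ioi (0 : ℝ), Real.exp (-t) * (A t - A' t)) :=
        (ofReal_integral_eq_lintegral_ofReal hint (ae_of_all _ hg')).symm
    -- The integral is the limit at infinity plus `A 0`, and that limit is nonpositive by `hsup`.
    _ ≤ ENNReal.ofReal (A 0) := by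
        rw [hval]
        refine ENNReal.ofReal_le_ofReal ?_
        simp only [neg_zero, Real.exp_zero, one_mul]
        linarith

lemma integrable_pow_expMeasure_one (n : ℕ) : Integrable (fun x : ℝ => x ^ n) (expMeasure 1) ∧
    ∫ x, x ^ n ∂(expMeasure 1) = n.factorial := by
  have hm : Measurable (exponentialPDF 1) := (measurable_exponentialPDFReal 1).ennreal_ofReal
  have htop : ∀ᵐ x : ℝ, exponentialPDF 1 x < ⊤ := ae_of_all _ fun _ => ENNReal.ofReal_lt_top
  have heq : (fun x : ℝ => (exponentialPDF 1 x).toReal • x ^ n) =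
      (Set.Ici (0 : ℝ)).indicator (fun x => Real.exp (-x) * x ^ ((n + 1 : ℝ) - 1)) := by
    funext x
    by_cases hx : 0 ≤ x
    · rw [Set.indicator_of_mem (Set.mem_Ici.2 hx), exponentialPDF_of_nonneg hx,
        ENNReal.toReal_ofReal (by positivity)]
      simp
    · rw [exponentialPDF_of_neg (not_le.1 hx), Set.indicator_of_notMem (by simpa using hx)]
      simp
  change Integrable _ (volume.withDensity (exponentialPDF 1)) ∧
    ∫ x, x ^ n ∂(volume.withDensity (exponentialPDF 1)) = _
  constructor
  · rw [integrable_withDensity_iff_integrable_smul' hm htop, heq,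
      integrable_indicator_iff measurableSet_Ici, integrableOn_Ici_iff_integrableOn_Ioi]
    exact Real.GammaIntegral_convergent (by positivity)
  · rw [integral_withDensity_eq_integral_toReal_smul hm htop, heq,
      integral_indicator measurableSet_Ici, integral_Ici_eq_integral_Ioi,
      ← Real.Gamma_eq_integral (by positivity), Real.Gamma_nat_eq_factorial]

lemma memLp_id_expMeasure_one : MemLp (id : ℝ → ℝ) 2 (expMeasure 1) :=
  (memLp_two_iff_integrable_sq measurable_id.aestronglyMeasurable).2
    (integrable_pow_expMeasure_one 2).1

lemma integral_id_expMeasure_one : ∫ x, id x ∂(expMeasure 1) = 1 := by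
  simpa using (integrable_pow_expMeasure_one 1).2

lemma variance_id_expMeasure_one : variance id (expMeasure 1) = 1 := by
  have := isProbabilityMeasure_expMeasure one_pos
  have h2 := (integrable_pow_expMeasure_one 2).2
  rw [variance_eq_sub memLp_id_expMeasure_one, integral_id_expMeasure_one]
  simp only [Pi.pow_apply, id, h2]
  norm_num

/-! ### Mean, variance and independence for the arrival times -/

namespace IsPoissonArrivalTimes

variable {Ω : Type*} [MeasurableSpace Ω] {P : Measure Ω} {T : ℕ → Ω → ℝ}

lemma measurable_increment (hT : IsPoissonArrivalTimes P T) (k : ℕ) :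
    Measurable (fun ω => T (k + 1) ω - T k ω) :=
  (hT.measurable _).sub (hT.measurable _)

lemma sum_increments (hT : IsPoissonArrivalTimes P T) (k : ℕ) :
    (∑ i ∈ Finset.range k, fun ω => T (i + 1) ω - T i ω) = T k := by
  funext ω
  rw [Finset.sum_apply, Finset.sum_range_sub (fun i => T i ω), hT.zero, sub_zero]

lemma memLp_increment (hT : IsPoissonArrivalTimes P T) (k : ℕ) :
    MemLp (fun ω => T (k + 1) ω - T k ω) 2 P := by
  have h := memLp_id_expMeasure_one
  rw [← hT.law k] at h
  exact (memLp_map_measure_iff measurable_id.aestronglyMeasurable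
    (hT.measurable_increment k).aemeasurable).1 h

lemma memLp (hT : IsPoissonArrivalTimes P T) (k : ℕ) : MemLp (T k) 2 P := by
  rw [← hT.sum_increments k]
  exact memLp_finsetSum' _ fun i _ => hT.memLp_increment i

lemma integral_increment (hT : IsPoissonArrivalTimes P T) (k : ℕ) :
    ∫ ω, (T (k + 1) ω - T k ω) ∂P = 1 := by
  rw [← integral_id_expMeasure_one, ← hT.law k,
    integral_map (hT.measurable_increment k).aemeasurable measurable_id.aestronglyMeasurable]
  rfl

lemma variance_increment (hT : IsPoissonArrivalTimes P T) (k : ℕ) :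
    variance (fun ω => T (k + 1) ω - T k ω) P = 1 := by
  rw [← variance_id_expMeasure_one, ← hT.law k,
    variance_map measurable_id.aemeasurable (hT.measurable_increment k).aemeasurable]
  rfl

lemma integral_eq [IsProbabilityMeasure P] (hT : IsPoissonArrivalTimes P T) (k : ℕ) :
    ∫ ω, T k ω ∂P = k := by
  rw [← hT.sum_increments k]
  simp only [Finset.sum_apply]
  rw [integral_finsetSum _ fun i _ => (hT.memLp_increment i).integrable one_le_two]
  simp [hT.integral_increment]

lemma variance_eq [IsProbabilityMeasure P] (hT : IsPoissonArrivalTimes P T) (k : ℕ) :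
    variance (T k) P = k := by
  rw [← hT.sum_increments k, IndepFun.variance_sum (fun i _ => hT.memLp_increment i)
    fun i _ j _ hij => hT.indep.indepFun hij]
  simp [hT.variance_increment]

/-- Chebyshev's inequality for the lower tail of the `k`-th arrival time. -/
lemma measureReal_lt_le [IsProbabilityMeasure P] (hT : IsPoissonArrivalTimes P T) {c : ℝ}
    (hc : 0 < c) {k : ℕ} (hk : 1 ≤ k) :
    P.real {ω | T k ω < (1 - c) * k} ≤ 1 / (c ^ 2 * k) := by
  have hk' : (0 : ℝ) < k := by exact_mod_cast hk
  have h := meas_ge_le_variance_div_sq (hT.memLp k) (mul_pos hc hk')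
  rw [hT.integral_eq, hT.variance_eq] at h
  have hsub : {ω | T k ω < (1 - c) * k} ⊆ {ω | c * k ≤ |T k ω - k|} := by
    intro ω hω
    have hω' : T k ω < (1 - c) * k := hω
    change c * k ≤ |T k ω - k|
    exact le_abs.2 (Or.inr (by linarith))
  refine ENNReal.toReal_le_of_le_ofReal (by positivity) ((measure_mono hsub).trans (h.trans_eq ?_))
  congr 1
  field_simp

/-- The `k`-th increment is independent of everything built from the previous increments. -/
lemma indepFun_increment (hT : IsPoissonArrivalTimes P T) (k : ℕ) {β : Type*}
    [MeasurableSpace β] {X : Ω → β}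
    (hX : Measurable[⨆ i ∈ Set.Iio k,
      MeasurableSpace.comap (fun ω => T (i + 1) ω - T i ω) inferInstance] X) :
    IndepFun X (fun ω => T (k + 1) ω - T k ω) P := by
  have h := indep_iSup_of_disjoint (fun i => (hT.measurable_increment i).comap_le)
    ((iIndepFun_iff_iIndep _ _ _).1 hT.indep)
    (S := Set.Iio k) (T := {k}) (by simp)
  rw [IndepFun_iff_Indep]
  exact indep_of_indep_of_le_left (indep_of_indep_of_le_right h (by simp)) hX.comap_le

end IsPoissonArrivalTimes

/-! ### Lyapunov decay under the flow and the jump -/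

section Lyapunov

variable {d : ℕ} {f : EuclideanSpace ℝ (Fin d) → ℝ} {wStar : EuclideanSpace ℝ (Fin d)}
  {ρ μ L : ℝ}

/-- The Lyapunov function `f w - f w* + (μ/2) ‖z - w*‖²`. -/
noncomputable def sqcLyapunov (μ : ℝ) (f : EuclideanSpace ℝ (Fin d) → ℝ)
    (wStar : EuclideanSpace ℝ (Fin d))
    (p : EuclideanSpace ℝ (Fin d) × EuclideanSpace ℝ (Fin d)) : ℝ :=
  f p.1 - f wStar + μ / 2 * ‖p.2 - wStar‖ ^ 2

/-- The flow `w' = s (z - w)`, `z' = ρ s (w - z)` with `s = √(μ/L)` followed between two jumps. -/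
noncomputable def sqcFlow (ρ μ L : ℝ)
    (p : EuclideanSpace ℝ (Fin d) × EuclideanSpace ℝ (Fin d)) (t : ℝ) :
    EuclideanSpace ℝ (Fin d) × EuclideanSpace ℝ (Fin d) :=
  (p.1 + (1 / (1 + ρ) * (1 - Real.exp (-(1 + ρ) * √(μ / L) * t))) • (p.2 - p.1),
    p.2 + (ρ / (1 + ρ) * (1 - Real.exp (-(1 + ρ) * √(μ / L) * t))) • (p.1 - p.2))

/-- The gradient jump of both variables. -/
noncomputable def sqcJump (μ L : ℝ) (f : EuclideanSpace ℝ (Fin d) → ℝ)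
    (p : EuclideanSpace ℝ (Fin d) × EuclideanSpace ℝ (Fin d)) :
    EuclideanSpace ℝ (Fin d) × EuclideanSpace ℝ (Fin d) :=
  (p.1 - (1 / L) • gradient f p.1, p.2 - (1 / √(μ * L)) • gradient f p.1)

lemma sqcLyapunov_nonneg (hμ : 0 < μ) (hquasar : IsStronglyQuasarConvex ρ μ f wStar)
    (p : EuclideanSpace ℝ (Fin d) × EuclideanSpace ℝ (Fin d)) : 0 ≤ sqcLyapunov μ f wStar p := by
  have := hquasar.isMin p.1
  unfold sqcLyapunov
  have : 0 ≤ μ / 2 * ‖p.2 - wStar‖ ^ 2 := by positivity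
  linarith

/-- The generator inequality: the Lyapunov function decays at rate `ρ √(μ/L)`. -/
lemma sqcLyapunov_generator_le (hρ : 0 < ρ) (hμ : 0 < μ) (hL : 0 < L) (hsmooth : IsLSmooth L f)
    (hquasar : IsStronglyQuasarConvex ρ μ f wStar)
    (p : EuclideanSpace ℝ (Fin d) × EuclideanSpace ℝ (Fin d)) :
    ρ * √(μ / L) * sqcLyapunov μ f wStar p + √(μ / L) * inner ℝ (gradient f p.1) (p.2 - p.1)
      + μ * (ρ * √(μ / L)) * inner ℝ (p.2 - wStar) (p.1 - p.2)
      + sqcLyapunov μ f wStar (sqcJump μ L f p) ≤ sqcLyapunov μ f wStar p := by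
  obtain ⟨v, z⟩ := p
  set g := gradient f v with hg
  set s := √(μ / L) with hs
  have hs0 : 0 < s := Real.sqrt_pos.2 (by positivity)
  have hss : s ^ 2 = μ / L := Real.sq_sqrt (by positivity)
  -- With this step size, the jump of `(μ/2) ‖z - w*‖²` has linear part `-s ⟨g, z - w*⟩` and
  -- quadratic part `‖g‖² / (2L)`, which the descent of `f` in `h1'` cancels exactly.
  have hγ : 1 / √(μ * L) = s / μ := by
    rw [one_div, inv_eq_iff_eq_inv, inv_div, eq_div_iff hs0.ne', hs, ← Real.sqrt_mul (by positivity)]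
    rw [show μ * L * (μ / L) = μ ^ 2 by field_simp]
    exact Real.sqrt_sq hμ.le
  have h1 := hsmooth.upper_bound (v - (1 / L) • g) v
  have h2 := hquasar.quasar v
  rw [← hg] at h1 h2
  have e1 : v - (1 / L) • g - v = -((1 / L) • g) := by abel
  rw [e1, inner_neg_right, norm_neg, inner_smul_right, norm_smul, real_inner_self_eq_norm_sq,
    mul_pow, Real.norm_eq_abs, sq_abs] at h1
  have h1' : f (v - (1 / L) • g) ≤ f v - 1 / (2 * L) * ‖g‖ ^ 2 := by
    refine h1.trans_eq ?_
    field_simp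
    ring
  have h2' : inner ℝ g (wStar - v) ≤ ρ * (f wStar - f v - μ / 2 * ‖wStar - v‖ ^ 2) := by
    have : 1 / ρ * inner ℝ g (wStar - v) ≤ f wStar - f v - μ / 2 * ‖wStar - v‖ ^ 2 := by linarith
    rwa [one_div, inv_mul_le_iff₀ hρ] at this
  have h3 := mul_le_mul_of_nonneg_left h2' hs0.le
  have e2 : ‖z - (1 / √(μ * L)) • g - wStar‖ ^ 2 =
      ‖z - wStar‖ ^ 2 - 2 * (s / μ) * inner ℝ g (z - wStar) + (s / μ) ^ 2 * ‖g‖ ^ 2 := by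
    rw [hγ, show z - (s / μ) • g - wStar = (z - wStar) - (s / μ) • g by abel, norm_sub_sq_real,
      inner_smul_right, norm_smul, mul_pow, Real.norm_eq_abs, sq_abs, real_inner_comm]
    ring
  have e3 : inner ℝ g (z - wStar) = inner ℝ g (z - v) - inner ℝ g (wStar - v) := by
    rw [← inner_sub_right]; congr 1; abel
  have e4 : ‖wStar - v‖ ^ 2 = ‖z - wStar‖ ^ 2 + 2 * inner ℝ (z - wStar) (v - z) + ‖v - z‖ ^ 2 := by
    rw [← norm_add_sq_real, ← norm_neg]; congr 2; abel
  have e5 : μ / 2 * ((s / μ) ^ 2 * ‖g‖ ^ 2) = 1 / (2 * L) * ‖g‖ ^ 2 := by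
    rw [div_pow, hss]; field_simp
  have e6 : μ / 2 * (2 * (s / μ) * inner ℝ g (z - wStar)) = s * inner ℝ g (z - wStar) := by
    field_simp
  have h4 : 0 ≤ μ * ρ * s / 2 * ‖v - z‖ ^ 2 := by positivity
  simp only [sqcLyapunov, sqcJump, ← hg]
  have e7 : μ / 2 * ‖z - (1 / √(μ * L)) • g - wStar‖ ^ 2 = μ / 2 * ‖z - wStar‖ ^ 2
      - s * inner ℝ g (z - wStar) + 1 / (2 * L) * ‖g‖ ^ 2 := by
    rw [e2, mul_add, mul_sub, e5, e6]
  -- Splitting at `v` makes `⟨g, z - v⟩` cancel the flow term and leaves `s ⟨g, w* - v⟩` to quasar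
  -- convexity. After expanding `‖w* - v‖²` around `z`, only `-(μ ρ s / 2) ‖v - z‖² ≤ 0` survives.
  rw [e7, e3]
  rw [e4] at h3
  linarith

lemma hasDerivAt_sqcLyapunov_sqcFlow (hρ : 0 < ρ) (hf : Differentiable ℝ f)
    (p : EuclideanSpace ℝ (Fin d) × EuclideanSpace ℝ (Fin d)) (t : ℝ) :
    HasDerivAt (fun t => sqcLyapunov μ f wStar (sqcFlow ρ μ L p t))
      (√(μ / L) * inner ℝ (gradient f (sqcFlow ρ μ L p t).1)
          ((sqcFlow ρ μ L p t).2 - (sqcFlow ρ μ L p t).1)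
        + μ * (ρ * √(μ / L)) * inner ℝ ((sqcFlow ρ μ L p t).2 - wStar)
          ((sqcFlow ρ μ L p t).1 - (sqcFlow ρ μ L p t).2)) t := by
  obtain ⟨w, z⟩ := p
  set s := √(μ / L)
  have hρ1 : (1 + ρ) ≠ 0 := by positivity
  set E : ℝ → ℝ := fun t => Real.exp (-(1 + ρ) * s * t)
  have hE : HasDerivAt (fun t => 1 - E t) ((1 + ρ) * s * E t) t := by
    have := (((hasDerivAt_id t).const_mul (-(1 + ρ) * s)).exp).const_sub 1
    convert! this using 1
    simp only [E, id]
    ring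
  -- The gap `z - w` contracts at rate `(1 + ρ) s`; both equations of the flow follow from this.
  have hdiff : (sqcFlow ρ μ L (w, z) t).2 - (sqcFlow ρ μ L (w, z) t).1 = E t • (z - w) := by
    have : (sqcFlow ρ μ L (w, z) t).2 - (sqcFlow ρ μ L (w, z) t).1 =
        (1 - (1 / (1 + ρ) * (1 - E t)) - (ρ / (1 + ρ) * (1 - E t))) • (z - w) := by
      simp only [sqcFlow, E, s]
      module
    rw [this]
    congr 1
    field_simp
    ring
  have hw : HasDerivAt (fun t => (sqcFlow ρ μ L (w, z) t).1)
      (s • ((sqcFlow ρ μ L (w, z) t).2 - (sqcFlow ρ μ L (w, z) t).1)) t := by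
    have := ((hE.const_mul (1 / (1 + ρ))).smul_const (z - w)).const_add w
    convert! this using 1
    rw [hdiff, smul_smul]
    congr 1
    field_simp
  have hz : HasDerivAt (fun t => (sqcFlow ρ μ L (w, z) t).2)
      ((ρ * s) • ((sqcFlow ρ μ L (w, z) t).1 - (sqcFlow ρ μ L (w, z) t).2)) t := by
    have := ((hE.const_mul (ρ / (1 + ρ))).smul_const (w - z)).const_add z
    convert! this using 1
    rw [← neg_sub (sqcFlow ρ μ L (w, z) t).2, hdiff, ← smul_neg, neg_sub, smul_smul]
    congr 1
    field_simp
  have h1 := (hf (sqcFlow ρ μ L (w, z) t).1).hasGradientAt.hasFDerivAt.comp_hasDerivAt t hw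
  have h2 := ((hz.sub_const wStar).norm_sq).const_mul (μ / 2)
  convert! (h1.sub_const (f wStar)).add h2 using 1
  rw [InnerProductSpace.toDual_apply_apply, inner_smul_right, inner_smul_right]
  ring

/-- Averaged over an exponential time, flow and jump do not increase the rescaled Lyapunov
function. -/
lemma lintegral_sqcLyapunov_le (hρ : 0 < ρ) (hμ : 0 < μ) (hL : 0 < L) (hsmooth : IsLSmooth L f)
    (hquasar : IsStronglyQuasarConvex ρ μ f wStar)
    (p : EuclideanSpace ℝ (Fin d) × EuclideanSpace ℝ (Fin d)) :
    ∫⁻ t, ENNReal.ofReal (Real.exp (ρ * √(μ / L) * t) *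
        sqcLyapunov μ f wStar (sqcJump μ L f (sqcFlow ρ μ L p t))) ∂(expMeasure 1) ≤
      ENNReal.ofReal (sqcLyapunov μ f wStar p) := by
  have hA : ∀ t, HasDerivAt (fun t => Real.exp (ρ * √(μ / L) * t) *
      sqcLyapunov μ f wStar (sqcFlow ρ μ L p t)) _ t := fun t =>
    ((((hasDerivAt_id t).const_mul (ρ * √(μ / L))).exp)).fun_mul
      (hasDerivAt_sqcLyapunov_sqcFlow hρ hsmooth.differentiable p t)
  refine (lintegral_expMeasure_le_of_hasDerivAt hA
    (fun t => mul_nonneg (Real.exp_pos _).le (sqcLyapunov_nonneg hμ hquasar _))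
    (fun t => mul_nonneg (Real.exp_pos _).le (sqcLyapunov_nonneg hμ hquasar _))
    fun t => ?_).trans_eq ?_
  -- Differentiating the exponential weight supplies the term `ρ √(μ/L) V` of the generator
  -- inequality.
  · have := mul_le_mul_of_nonneg_left
      (sqcLyapunov_generator_le hρ hμ hL hsmooth hquasar (sqcFlow ρ μ L p t))
      (Real.exp_pos (ρ * √(μ / L) * t)).le
    simp only [id]
    linarith
  · simp [sqcFlow]

/-- Since `v - z = (1 - τ) (w - z)` with `1 - τ = (ρ + E) / (1 + ρ)`, the denominator of `τ'` makes
`τ' (1 - τ) = ρ (1 - E) / (1 + ρ)`, the coefficient of the flow. -/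
lemma discreteIterates_succ_eq_sqcJump_sqcFlow (hρ : 0 < ρ) (t : ℕ → ℝ)
    (w₀ z₀ : EuclideanSpace ℝ (Fin d)) (k : ℕ) :
    discreteIterates f (sqcTau ρ μ L t) (sqcTau' ρ μ L t) (fun _ => 1 / L)
        (fun _ => 1 / √(μ * L)) w₀ z₀ (k + 1) =
      sqcJump μ L f (sqcFlow ρ μ L (discreteIterates f (sqcTau ρ μ L t) (sqcTau' ρ μ L t)
        (fun _ => 1 / L) (fun _ => 1 / √(μ * L)) w₀ z₀ k) (t (k + 1) - t k)) := by
  rw [discreteIterates]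
  generalize discreteIterates f (sqcTau ρ μ L t) (sqcTau' ρ μ L t) (fun _ => 1 / L)
    (fun _ => 1 / √(μ * L)) w₀ z₀ k = p
  obtain ⟨w, z⟩ := p
  simp only [sqcJump, sqcFlow, sqcTau, sqcTau']
  set E := Real.exp (-(1 + ρ) * √(μ / L) * (t (k + 1) - t k))
  have hE : 0 < E := Real.exp_pos _
  congr 2
  rw [show w + (1 / (1 + ρ) * (1 - E)) • (z - w) - z = (1 - 1 / (1 + ρ) * (1 - E)) • (w - z) by
    module, smul_smul]
  congr 2
  field_simp
  ring

/-! ### Measurability and the supermartingale bound -/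

lemma measurable_gradient (f : EuclideanSpace ℝ (Fin d) → ℝ) : Measurable (gradient f) :=
  (InnerProductSpace.toDual ℝ (EuclideanSpace ℝ (Fin d))).symm.continuous.measurable.comp
    (measurable_fderiv ℝ f)

lemma measurable_sqcJump : Measurable (sqcJump (d := d) μ L f) := by
  have := measurable_gradient f
  unfold sqcJump
  fun_prop

lemma measurable_sqcFlow : Measurable (fun q : (EuclideanSpace ℝ (Fin d) ×
    EuclideanSpace ℝ (Fin d)) × ℝ => sqcFlow ρ μ L q.1 q.2) := by
  unfold sqcFlow
  fun_prop

lemma measurable_sqcLyapunov (hf : Differentiable ℝ f) : Measurable (sqcLyapunov μ f wStar) := by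
  have := hf.continuous.measurable
  unfold sqcLyapunov
  fun_prop

variable {Ω : Type*} [MeasurableSpace Ω] {P : Measure Ω} {T : ℕ → Ω → ℝ}

/-- The iterates and the clock after `k` steps depend only on the first `k` increments. -/
lemma measurable_discreteIterates_prodMk (hρ : 0 < ρ) (hT : IsPoissonArrivalTimes P T)
    (w₀ z₀ : EuclideanSpace ℝ (Fin d)) (k : ℕ) :
    Measurable[⨆ i ∈ Set.Iio k,
        MeasurableSpace.comap (fun ω => T (i + 1) ω - T i ω) inferInstance]
      (fun ω => (discreteIterates f (sqcTau ρ μ L fun j => T j ω) (sqcTau' ρ μ L fun j => T j ω)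
        (fun _ => 1 / L) (fun _ => 1 / √(μ * L)) w₀ z₀ k, T k ω)) := by
  induction k with
  | zero =>
    simp only [discreteIterates, hT.zero]
    exact measurable_const
  | succ k ih =>
    have ih' := ih.mono (iSup₂_mono' fun i hi =>
      ⟨i, lt_trans (Set.mem_Iio.1 hi) k.lt_succ_self, le_rfl⟩ :
        _ ≤ ⨆ i ∈ Set.Iio (k + 1),
          MeasurableSpace.comap (fun ω => T (i + 1) ω - T i ω) inferInstance) le_rfl
    have hΔ : Measurable[⨆ i ∈ Set.Iio (k + 1),
        MeasurableSpace.comap (fun ω => T (i + 1) ω - T i ω) inferInstance]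
        (fun ω => T (k + 1) ω - T k ω) :=
      (comap_measurable _).mono (le_iSup₂_of_le k (Set.mem_Iio.2 k.lt_succ_self) le_rfl) le_rfl
    have hΦ : Measurable (fun q : ((EuclideanSpace ℝ (Fin d) × EuclideanSpace ℝ (Fin d)) × ℝ) × ℝ =>
        (sqcJump μ L f (sqcFlow ρ μ L q.1.1 q.2), q.1.2 + q.2)) :=
      (measurable_sqcJump.comp (measurable_sqcFlow.comp
        ((measurable_fst.comp measurable_fst).prodMk measurable_snd))).prodMk
        ((measurable_snd.comp measurable_fst).add measurable_snd)
    convert! hΦ.comp (ih'.prodMk hΔ) using 1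
    funext ω
    simp only [Function.comp, discreteIterates_succ_eq_sqcJump_sqcFlow hρ, add_sub_cancel]

/-- The rescaled Lyapunov function is a supermartingale along the jump times. -/
lemma lintegral_exp_mul_sqcLyapunov_le [IsProbabilityMeasure P] (hρ : 0 < ρ) (hμ : 0 < μ)
    (hL : 0 < L) (hsmooth : IsLSmooth L f) (hquasar : IsStronglyQuasarConvex ρ μ f wStar)
    (hT : IsPoissonArrivalTimes P T) (w₀ z₀ : EuclideanSpace ℝ (Fin d)) (k : ℕ) :
    ∫⁻ ω, ENNReal.ofReal (Real.exp (ρ * √(μ / L) * T k ω) * sqcLyapunov μ f wStar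
        (discreteIterates f (sqcTau ρ μ L fun j => T j ω) (sqcTau' ρ μ L fun j => T j ω)
          (fun _ => 1 / L) (fun _ => 1 / √(μ * L)) w₀ z₀ k)) ∂P ≤
      ENNReal.ofReal (sqcLyapunov μ f wStar (w₀, z₀)) := by
  induction k with
  | zero => simp [discreteIterates, hT.zero]
  | succ k ih =>
    refine le_trans ?_ ih
    have hX := measurable_discreteIterates_prodMk (f := f) (μ := μ) (L := L) hρ hT w₀ z₀ k
    have hind := hT.indepFun_increment k hX
    have hX' := hX.mono (iSup₂_le fun i _ => (hT.measurable_increment i).comap_le) le_rfl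
    have hΔ := hT.measurable_increment k
    have hV := measurable_sqcLyapunov (μ := μ) (wStar := wStar) hsmooth.differentiable
    set X : Ω → (EuclideanSpace ℝ (Fin d) × EuclideanSpace ℝ (Fin d)) × ℝ := fun ω =>
      (discreteIterates f (sqcTau ρ μ L fun j => T j ω) (sqcTau' ρ μ L fun j => T j ω)
        (fun _ => 1 / L) (fun _ => 1 / √(μ * L)) w₀ z₀ k, T k ω) with hXdef
    let F : ((EuclideanSpace ℝ (Fin d) × EuclideanSpace ℝ (Fin d)) × ℝ) × ℝ → ENNReal := fun q =>
      ENNReal.ofReal (Real.exp (ρ * √(μ / L) * (q.1.2 + q.2)) *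
        sqcLyapunov μ f wStar (sqcJump μ L f (sqcFlow ρ μ L q.1.1 q.2)))
    have hF : Measurable F := by
      have h1 := hV.comp (measurable_sqcJump (f := f) (μ := μ) (L := L) |>.comp
        ((measurable_sqcFlow (ρ := ρ) (μ := μ) (L := L)).comp
          (((measurable_fst.comp measurable_fst).prodMk measurable_snd :
            Measurable fun q : ((EuclideanSpace ℝ (Fin d) × EuclideanSpace ℝ (Fin d)) × ℝ) × ℝ =>
              (q.1.1, q.2)))))
      exact (Measurable.mul (by fun_prop) h1).ennreal_ofReal
    have hprob := isProbabilityMeasure_expMeasure one_pos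
    have : IsProbabilityMeasure (P.map X) := Measure.isProbabilityMeasure_map hX'.aemeasurable
    -- Independence of the past `X` and the next increment allows integrating the increment first
    -- with the past frozen; the weight `exp (ρ √(μ/L) T k)` then factors out.
    calc _ = ∫⁻ ω, F (X ω, T (k + 1) ω - T k ω) ∂P := by
          refine lintegral_congr fun ω => ?_
          simp only [F, hXdef, discreteIterates_succ_eq_sqcJump_sqcFlow hρ, add_sub_cancel]
      _ = ∫⁻ q, F q ∂((P.map X).prod (expMeasure 1)) := by
          rw [← hT.law k, ← (indepFun_iff_map_prod_eq_prod_map_map hX'.aemeasurable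
            hΔ.aemeasurable).1 hind, lintegral_map hF (hX'.prodMk hΔ)]
      _ = ∫⁻ x, ∫⁻ t, F (x, t) ∂(expMeasure 1) ∂(P.map X) := lintegral_prod _ hF.aemeasurable
      _ ≤ ∫⁻ x, ENNReal.ofReal (Real.exp (ρ * √(μ / L) * x.2) * sqcLyapunov μ f wStar x.1)
            ∂(P.map X) := by
          refine lintegral_mono fun x => ?_
          rw [ENNReal.ofReal_mul (Real.exp_pos _).le]
          refine le_trans (le_of_eq ?_) (mul_le_mul_right
            (lintegral_sqcLyapunov_le hρ hμ hL hsmooth hquasar x.1) _)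
          rw [← lintegral_const_mul' _ _ ENNReal.ofReal_ne_top]
          refine lintegral_congr fun t => ?_
          rw [← ENNReal.ofReal_mul (Real.exp_pos _).le, ← mul_assoc, ← Real.exp_add, ← mul_add]
      _ = _ := by
          rw [lintegral_map ?_ hX']
          exact (Measurable.mul (by fun_prop) (hV.comp measurable_fst)).ennreal_ofReal

end Lyapunov

/-! ### Markov's inequality and the union bound -/

/-- Markov's inequality with a strict inequality, valid also for a vanishing bound. -/
lemma measureReal_mul_lt_le_of_lintegral_le {Ω : Type*} [MeasurableSpace Ω] {P : Measure Ω}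
    [IsProbabilityMeasure P] {Y : Ω → ℝ} (hY : Measurable Y) {a c₀ : ℝ} (ha : 0 ≤ a)
    (hc₀ : 0 < c₀) (h : ∫⁻ ω, ENNReal.ofReal (Y ω) ∂P ≤ ENNReal.ofReal a) :
    P.real {ω | c₀ * a < Y ω} ≤ 1 / c₀ := by
  refine ENNReal.toReal_le_of_le_ofReal (by positivity) ?_
  rcases ha.eq_or_lt with rfl | ha
  · rw [ENNReal.ofReal_zero, nonpos_iff_eq_zero,
      lintegral_eq_zero_iff hY.ennreal_ofReal] at h
    refine le_of_eq_of_le ?_ zero_le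
    rw [mul_zero]
    refine measure_mono_null (fun ω hω => ?_) (ae_iff.1 h)
    simpa using hω
  · have hM := mul_meas_ge_le_lintegral (μ := P) hY.ennreal_ofReal (ENNReal.ofReal (c₀ * a))
    have hca : 0 < c₀ * a := mul_pos hc₀ ha
    have hsub : {ω | c₀ * a < Y ω} ⊆ {ω | ENNReal.ofReal (c₀ * a) ≤ ENNReal.ofReal (Y ω)} :=
      fun ω hω => ENNReal.ofReal_le_ofReal (le_of_lt hω)
    refine (measure_mono hsub).trans ?_
    rw [show 1 / c₀ = a / (c₀ * a) by field_simp, ENNReal.ofReal_div_of_pos hca,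
      ENNReal.le_div_iff_mul_le (Or.inl (by simpa using hca)) (Or.inl ENNReal.ofReal_ne_top),
      mul_comm]
    exact hM.trans h

theorem corollary2 {d : ℕ} (f : EuclideanSpace ℝ (Fin d) → ℝ)
    (wStar : EuclideanSpace ℝ (Fin d)) (ρ μ L : ℝ) (hρ : 0 < ρ) (hμ : 0 < μ) (hL : 0 < L)
    (hsmooth : IsLSmooth L f) (hquasar : IsStronglyQuasarConvex ρ μ f wStar)
    {Ω : Type*} [MeasurableSpace Ω] (P : Measure Ω) [IsProbabilityMeasure P]
    (T : ℕ → Ω → ℝ) (hT : IsPoissonArrivalTimes P T)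
    (w₀ z₀ : EuclideanSpace ℝ (Fin d)) (c c₀ : ℝ) (hc : c ∈ Set.Ioo (0 : ℝ) 1) (hc₀ : 1 < c₀)
    (k : ℕ) (hk : 1 ≤ k) :
    1 - 1 / (c ^ 2 * (k : ℝ)) - 1 / c₀ ≤
      P.real {ω | f (sqcIterate ρ μ L f w₀ z₀ (fun j => T j ω) k) - f wStar ≤
        c₀ * (f w₀ - f wStar + μ / 2 * ‖z₀ - wStar‖ ^ 2) *
          Real.exp (-ρ * √(μ / L) * (1 - c) * (k : ℝ))} := by
  set V := sqcLyapunov μ f wStar with hV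
  set X : Ω → EuclideanSpace ℝ (Fin d) × EuclideanSpace ℝ (Fin d) := fun ω =>
    discreteIterates f (sqcTau ρ μ L fun j => T j ω) (sqcTau' ρ μ L fun j => T j ω)
      (fun _ => 1 / L) (fun _ => 1 / √(μ * L)) w₀ z₀ k with hX
  have hXT : Measurable (fun ω => (X ω, T k ω)) :=
    (measurable_discreteIterates_prodMk (f := f) (μ := μ) (L := L) hρ hT w₀ z₀ k).mono
      (iSup₂_le fun i _ => (hT.measurable_increment i).comap_le) le_rfl
  have hY : Measurable (fun ω => Real.exp (ρ * √(μ / L) * T k ω) * V (X ω)) :=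
    ((hT.measurable k).const_mul _).exp.mul
      ((measurable_sqcLyapunov hsmooth.differentiable).comp hXT.fst)
  have hc0 : 0 < c₀ := one_pos.trans hc₀
  have hMarkov := measureReal_mul_lt_le_of_lintegral_le (P := P) hY
    (sqcLyapunov_nonneg hμ hquasar (w₀, z₀)) hc0
    (lintegral_exp_mul_sqcLyapunov_le hρ hμ hL hsmooth hquasar hT w₀ z₀ k)
  have hCheb := hT.measureReal_lt_le hc.1 hk
  set G := {ω | f (sqcIterate ρ μ L f w₀ z₀ (fun j => T j ω) k) - f wStar ≤
    c₀ * (f w₀ - f wStar + μ / 2 * ‖z₀ - wStar‖ ^ 2) *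
      Real.exp (-ρ * √(μ / L) * (1 - c) * (k : ℝ))} with hG
  -- The bound can fail only if the clock is late or the rescaled Lyapunov function is large. These
  -- two events need not be independent, so a union bound is used.
  have hcover : (Set.univ : Set Ω) ⊆ G ∪ ({ω | T k ω < (1 - c) * k} ∪
      {ω | c₀ * V (w₀, z₀) < Real.exp (ρ * √(μ / L) * T k ω) * V (X ω)}) := by
    intro ω _
    by_cases h1 : T k ω < (1 - c) * k
    · exact Or.inr (Or.inl h1)
    by_cases h2 : c₀ * V (w₀, z₀) < Real.exp (ρ * √(μ / L) * T k ω) * V (X ω)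
    · exact Or.inr (Or.inr h2)
    refine Or.inl ?_
    rw [not_lt] at h1 h2
    have hs : 0 ≤ ρ * √(μ / L) := by positivity
    have hV0 : 0 ≤ c₀ * V (w₀, z₀) := mul_nonneg hc0.le (sqcLyapunov_nonneg hμ hquasar _)
    have hle : f (X ω).1 - f wStar ≤ V (X ω) := by
      have : 0 ≤ μ / 2 * ‖(X ω).2 - wStar‖ ^ 2 := by positivity
      simp only [hV, sqcLyapunov]
      linarith
    calc f (X ω).1 - f wStar ≤ V (X ω) := hle
      _ ≤ c₀ * V (w₀, z₀) * Real.exp (-(ρ * √(μ / L) * T k ω)) := by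
        rw [Real.exp_neg, ← div_eq_mul_inv, le_div_iff₀ (Real.exp_pos _), mul_comm]
        exact h2
      _ ≤ c₀ * V (w₀, z₀) * Real.exp (-ρ * √(μ / L) * (1 - c) * (k : ℝ)) := by
        refine mul_le_mul_of_nonneg_left (Real.exp_le_exp.2 ?_) hV0
        linarith [mul_le_mul_of_nonneg_left h1 hs]
  have h := (measureReal_mono (μ := P) hcover).trans ((measureReal_union_le _ _).trans
    (add_le_add_right (measureReal_union_le _ _) _))
  rw [probReal_univ] at h
  linarith
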